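/- Let $P$ be a finite poset, and let $\mathbf e_i$ ($i\in P$) be the standard basis of $\mathbb R^P$. A filter of $P$ is an upward closed subset; for a filter $F$ let $F_{\min}$ be its set of minimal elements. The enriched order polytope of $P$ is $$\mathcal O^{(e)}_P=\operatorname{conv}\Big\{\sum_{i\in F_{\min}}\varepsilon_i\mathbf e_i+\sum_{i\in F\setminus F_{\min}}\mathbf e_i : F\text{ a filter of }P,\ \varepsilon\in\{-1,1\}^{F_{\min}}\Big\},$$ and the enriched chain polytope of $P$ is $$\mathcal C^{(e)}_P=\operatorname{conv}\Big\{\sum_{i\in A}\varepsilon_i\mathbf e_i : A\text{ an antichain of }P,\ \varepsilon\in\{-1,1\}^{A}\Big\}.$$ A facet of a polytope is a nonempty face of codimension one in it. A polytope $\mathcal Q$ is called centrally symmetric if for every facet $\mathcal F$ of $\mathcal Q$, $-\mathcal F$ is also a facet of $\mathcal Q$. Polytopes $\mathcal Q,\mathcal R\subset\mathbb R^P$ are called unimodularly equivalent if $\mathcal R=\{xU+w : x\in\mathcal Q\}$ for some integer matrix $U\in\mathbb Z^{P\times P}$ with $\det U=\pm1$ and some $w\in\mathbb Z^P$. Then the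 following conditions are equivalent: (i) $P$ is an antichain; (ii) $\mathcal O^{(e)}_P$ and $\mathcal C^{(e)}_P$ are unimodularly equivalent; (iii) $\mathcal O^{(e)}_P$ is centrally symmetric; (iv) the number of facets of $\mathcal O^{(e)}_P$ is equal to the number of facets of $\mathcal C^{(e)}_P$. -/

import Mathlib

open scoped Matrix Pointwise

namespace EnrichedPoset

/-- The vector `∑ i ∈ X, ε i • e i` of `ℝ^P`, for `X ⊆ P` and signs `ε`. Only the signs of the
elements of `X` matter. -/
noncomputable def signedVec {P : Type*} (X : Set P) (ε : P → ℤˣ) : P → ℝ :=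
  X.indicator fun i => (((ε i : ℤˣ) : ℤ) : ℝ)

/-- The set of minimal elements of a subset `F` of a poset. -/
def minElts {P : Type*} [PartialOrder P] (F : Set P) : Set P :=
  {i | Minimal (· ∈ F) i}

/-- The enriched order polytope of a finite poset `P`: the convex hull of the vectors
`∑ i ∈ min F, ε i • e i + ∑ i ∈ F \ min F, e i`, over all filters (upper sets) `F` of `P` and all
choices of signs on `min F`. -/
def enrichedOrderPolytope (P : Type*) [PartialOrder P] : Set (P → ℝ) :=
  convexHull ℝ {x | ∃ (F : UpperSet P) (ε : P → ℤˣ),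
    x = signedVec (minElts (F : Set P)) ε + signedVec ((F : Set P) \ minElts (F : Set P)) 1}

/-- The enriched chain polytope of a finite poset `P`: the convex hull of the vectors
`∑ i ∈ A, ε i • e i`, over all antichains `A` of `P` and all choices of signs on `A`. -/
def enrichedChainPolytope (P : Type*) [PartialOrder P] : Set (P → ℝ) :=
  convexHull ℝ {x | ∃ (A : Set P) (ε : P → ℤˣ),
    IsAntichain (· ≤ ·) A ∧ x = signedVec A ε}

/-- `F` is a facet of the polytope `Q`: a nonempty face (the set of all points of `Q` where some
linear functional attains its maximum over `Q`) of dimension `dim Q - 1`. -/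
def IsFacet {E : Type*} [AddCommGroup E] [Module ℝ E] [TopologicalSpace E]
    (Q F : Set E) : Prop :=
  F.Nonempty ∧ IsExposed ℝ Q F ∧
    Module.finrank ℝ (vectorSpan ℝ F) + 1 = Module.finrank ℝ (vectorSpan ℝ Q)

/-- A polytope is centrally symmetric if the negative of each of its facets is again one of its
facets. -/
def IsCentrallySymmetric {E : Type*} [AddCommGroup E] [Module ℝ E] [TopologicalSpace E]
    (Q : Set E) : Prop :=
  ∀ F : Set E, IsFacet Q F → IsFacet Q (-F)

/-- The number of facets of a polytope. -/
noncomputable def numFacets {E : Type*} [AddCommGroup E] [Module ℝ E] [TopologicalSpace E]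
    (Q : Set E) : ℕ∞ :=
  {F : Set E | IsFacet Q F}.encard

/-- Unimodular equivalence: `R = f_U(Q) + w` for an integer matrix `U` of determinant `±1` and an
integer vector `w`, where `f_U(x) = x U`. -/
def UnimodularlyEquivalent {ι : Type*} [Fintype ι] [DecidableEq ι] (Q R : Set (ι → ℝ)) : Prop :=
  ∃ (U : Matrix ι ι ℤ) (w : ι → ℤ), IsUnit U.det ∧
    R = (fun x : ι → ℝ => x ᵥ* U.map (Int.cast : ℤ → ℝ) + fun i => (w i : ℝ)) '' Q

end EnrichedPoset

namespace EnrichedPoset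

/-! If `P` is an antichain, filters and antichains are both arbitrary subsets and every element of a
filter is minimal, so the two polytopes coincide. This common polytope equals its negative, hence is
centrally symmetric. Unimodular equivalence is an affine isomorphism and preserves the number of
facets. Two implications carry the content.

Facet count: the chain polytope has a separate facet `∑ i ∈ C, ε i * x i = 1` for each maximal chain
`C` and each sign choice on `C`, so at least `∑ C, 2 ^ #C` facets
(`card_le_numFacets_enrichedChainPolytope`). The order polytope is cut out by `#C + 1` inequalities
per maximal chain (`mem_enrichedOrderPolytope_iff`), and each facet comes from one of them
(`IsFacet.eq_of_forall_le_one`). Since `n + 1 ≤ 2 ^ n`, strictly for `n ≥ 2`, equal counts leave no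
chain of two elements. The half-space description comes from writing `x = 2 S - T` with `S ≤ T`, and
`T i ≤ S j` for `i < j`; the level sets of `S` and `T` then express `x` as an integral of vertices.

Symmetry: if `k < m` with `m` maximal, `x m = 1` defines a facet of the order polytope, but the
negative of one of its points leaves the polytope. -/

theorem finrank_vectorSpan_add_one {E : Type*} [AddCommGroup E] [Module ℝ E]
    [FiniteDimensional ℝ E] {F : Set E} {l : E →ₗ[ℝ] ℝ}
    (hl : l ≠ 0) {c : ℝ} (hF : ∀ x ∈ F, l x = c) (p : E)
    (hp : vectorSpan ℝ F ⊔ Submodule.span ℝ {p} = ⊤) :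
    Module.finrank ℝ (vectorSpan ℝ F) + 1 = Module.finrank ℝ E := by
  have hle : vectorSpan ℝ F ≤ LinearMap.ker l := by
    rw [vectorSpan_def, Submodule.span_le]
    rintro _ ⟨x, hx, y, hy, rfl⟩
    simp [hF x hx, hF y hy]
  have h1 : Module.finrank ℝ (vectorSpan ℝ F) < Module.finrank ℝ E := by
    refine Submodule.finrank_lt (lt_of_le_of_lt hle (lt_top_iff_ne_top.2 ?_)).ne
    rwa [Ne, LinearMap.ker_eq_top]
  have h2 := Submodule.finrank_add_le_finrank_add_finrank (vectorSpan ℝ F) (Submodule.span ℝ {p})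
  rw [hp, finrank_top] at h2
  have h3 := finrank_span_le_card (R := ℝ) {p}
  rw [Set.toFinset_singleton, Finset.card_singleton] at h3
  omega

/-! ### Facets of full-dimensional polytopes and their behaviour under affine maps -/

section Facets

variable {E : Type*} [AddCommGroup E] [Module ℝ E] [TopologicalSpace E]

/-- Facets are carried to facets by continuous affine equivalences with linear part `L`. -/
theorem IsFacet.image {Q F : Set E} (h : IsFacet Q F) (L : E ≃L[ℝ] E) (w : E) :
    IsFacet ((fun x => L x + w) '' Q) ((fun x => L x + w) '' F) := by
  have hspan : ∀ S : Set E, Module.finrank ℝ (vectorSpan ℝ ((fun x => L x + w) '' S)) =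
      Module.finrank ℝ (vectorSpan ℝ S) := by
    intro S
    let f : E →ᵃ[ℝ] E := L.toLinearEquiv.toLinearMap.toAffineMap + AffineMap.const ℝ E w
    have hf : (fun x => L x + w) = f := by ext x; simp [f]
    have hl : f.linear = L.toLinearEquiv.toLinearMap := by simp [f]
    rw [hf, ← AffineMap.map_vectorSpan, hl]
    exact LinearEquiv.finrank_map_eq L.toLinearEquiv _
  obtain ⟨hne, hexp, hdim⟩ := h
  refine ⟨hne.image _, fun _ => ?_, by rw [hspan, hspan, hdim]⟩
  obtain ⟨l, rfl⟩ := hexp hne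
  refine ⟨l.comp (L.symm : E →L[ℝ] E), ?_⟩
  ext y
  constructor
  · rintro ⟨x, ⟨hx, hmax⟩, rfl⟩
    refine ⟨⟨x, hx, rfl⟩, ?_⟩
    rintro _ ⟨z, hz, rfl⟩
    simpa using hmax z hz
  · rintro ⟨⟨x, hx, rfl⟩, hmax⟩
    exact ⟨x, ⟨hx, fun z hz => by simpa using hmax _ ⟨z, hz, rfl⟩⟩, rfl⟩

theorem numFacets_le_image (Q : Set E) (L : E ≃L[ℝ] E) (w : E) :
    numFacets Q ≤ numFacets ((fun x => L x + w) '' Q) := by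
  refine Set.encard_le_encard_of_injOn (f := fun F => (fun x => L x + w) '' F)
    (fun F hF => IsFacet.image hF L w) ?_
  exact (Set.image_injective.2 fun x y h => by simpa using h).injOn

theorem numFacets_image (Q : Set E) (L : E ≃L[ℝ] E) (w : E) :
    numFacets ((fun x => L x + w) '' Q) = numFacets Q := by
  refine le_antisymm ?_ (numFacets_le_image Q L w)
  refine (numFacets_le_image _ L.symm (-L.symm w)).trans_eq ?_
  rw [Set.image_image]
  simp

theorem isCentrallySymmetric_of_neg_eq [IsTopologicalAddGroup E] {Q : Set E} (h : -Q = Q) :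
    IsCentrallySymmetric Q := by
  intro F hF
  have := hF.image (ContinuousLinearEquiv.neg ℝ) 0
  simpa [h] using this

theorem UnimodularlyEquivalent.numFacets_eq {ι : Type*} [Fintype ι] [DecidableEq ι]
    {Q R : Set (ι → ℝ)} (h : UnimodularlyEquivalent Q R) : numFacets Q = numFacets R := by
  obtain ⟨U, w, hU, rfl⟩ := h
  have hV : IsUnit (U.map (Int.cast : ℤ → ℝ)).det := by
    have := hU.map (Int.castRingHom ℝ)
    rwa [RingHom.map_det] at this
  let V := U.map (Int.cast : ℤ → ℝ)
  have h1 : V * V⁻¹ = 1 := Matrix.mul_nonsing_inv _ hV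
  have h2 : V⁻¹ * V = 1 := Matrix.nonsing_inv_mul _ hV
  let L : (ι → ℝ) ≃ₗ[ℝ] (ι → ℝ) := LinearEquiv.ofLinearMap (Matrix.vecMulLinear V)
    (Matrix.vecMulLinear V⁻¹) (LinearMap.ext fun x => by simp [Matrix.vecMul_vecMul, h2])
    (LinearMap.ext fun x => by simp [Matrix.vecMul_vecMul, h1])
  exact (numFacets_image Q L.toContinuousLinearEquiv fun i => (w i : ℝ)).symm

/-- A facet of a full-dimensional polytope `{x | ∀ k, a k x ≤ 1}` is cut out by one of the
defining inequalities. -/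
theorem IsFacet.eq_of_forall_le_one [FiniteDimensional ℝ E] {ι : Type*} [Finite ι]
    {Q F : Set E} {a : ι → E →ₗ[ℝ] ℝ} (hQ : ∀ x, x ∈ Q ↔ ∀ k, a k x ≤ 1)
    (hspan : vectorSpan ℝ Q = ⊤) (h : IsFacet Q F) :
    ∃ k, F = {x ∈ Q | a k x = 1} := by
  classical
  cases nonempty_fintype ι
  obtain ⟨hne, hexp, hdim⟩ := h
  obtain ⟨l, hl⟩ := hexp hne
  have hFmem : ∀ x, x ∈ F ↔ x ∈ Q ∧ ∀ y ∈ Q, l y ≤ l x := fun x => by rw [hl]; rfl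
  have hconst : ∀ x ∈ F, ∀ y ∈ F, l x = l y := fun x hx y hy =>
    le_antisymm (((hFmem y).1 hy).2 x ((hFmem x).1 hx).1)
      (((hFmem x).1 hx).2 y ((hFmem y).1 hy).1)
  rw [hspan, finrank_top] at hdim
  have hk : ∃ k, ∀ x ∈ F, a k x = 1 := by
    by_contra! hcon
    -- If no single constraint is tight on all of `F`, averaging points of `F` makes all constraints
    -- strict at once.
    have hstrict : ∀ s : Finset ι, ∃ x ∈ F, ∀ k ∈ s, a k x < 1 := by
      intro s
      induction s using Finset.induction_on with
      | empty => exact hne.imp fun x hx => ⟨hx, by simp⟩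
      | insert k s _ ih =>
        obtain ⟨x, hx, hxs⟩ := ih
        obtain ⟨y, hy, hyk⟩ := hcon k
        have hxQ := (hQ x).1 ((hFmem x).1 hx).1
        have hyQ := (hQ y).1 ((hFmem y).1 hy).1
        refine ⟨(1 / 2 : ℝ) • x + (1 / 2 : ℝ) • y, (hFmem _).2 ⟨(hQ _).2 fun j => ?_, ?_⟩, ?_⟩
        · have := hxQ j; have := hyQ j
          simp only [map_add, map_smul, smul_eq_mul]; linarith
        · intro z hz
          have := ((hFmem x).1 hx).2 z hz
          have := ((hFmem y).1 hy).2 z hz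
          simp only [map_add, map_smul, smul_eq_mul]; linarith
        · intro j hj
          simp only [map_add, map_smul, smul_eq_mul]
          rcases Finset.mem_insert.1 hj with rfl | hj
          · have := hxQ j; have := lt_of_le_of_ne (hyQ j) hyk
            linarith
          · have := hxs j hj; have := hyQ j
            linarith
    obtain ⟨x, hx, hxs⟩ := hstrict Finset.univ
    -- That point is interior to `Q` and maximizes `l`. Small moves in every direction stay in `Q`,
    -- which forces `l = 0` and `F = Q`, against the dimension.
    have hl0 : ∀ v, l v ≤ 0 := by
      intro v
      have hev : ∀ᶠ t : ℝ in nhdsWithin 0 (Set.Ioi 0), ∀ k, a k x + t * a k v < 1 := by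
        rw [Filter.eventually_all]
        intro k
        apply Filter.Eventually.filter_mono nhdsWithin_le_nhds
        have : Continuous fun t : ℝ => a k x + t * a k v := by fun_prop
        exact this.continuousAt.eventually_lt continuousAt_const
          (by simpa using hxs k (Finset.mem_univ k))
      obtain ⟨t, ht, ht0⟩ := (hev.and self_mem_nhdsWithin).exists
      have hmem : x + t • v ∈ Q := (hQ _).2 fun k => by simpa using (ht k).le
      have := ((hFmem x).1 hx).2 _ hmem
      simp only [map_add, map_smul, smul_eq_mul, add_le_iff_nonpos_right] at this
      exact nonpos_of_mul_nonpos_right this ht0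
    have hl00 : ∀ v, l v = 0 := fun v =>
      le_antisymm (hl0 v) (by simpa using hl0 (-v))
    have : F = Q := by
      ext z; simp [hFmem, hl00]
    rw [this, hspan, finrank_top] at hdim
    omega
  obtain ⟨k, hk⟩ := hk
  refine ⟨k, Set.Subset.antisymm (fun x hx => ⟨((hFmem x).1 hx).1, hk x hx⟩) ?_⟩
  rintro x ⟨hxQ, hx1⟩
  obtain ⟨x₀, hx₀⟩ := hne
  -- The direction space of `F` has codimension one, so it is all of `ker (a k)`. As `l` vanishes on
  -- it, `l` is constant on `{a k = 1}`.
  have hle : vectorSpan ℝ F ≤ LinearMap.ker (a k) := by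
    rw [vectorSpan_def, Submodule.span_le]
    rintro _ ⟨x, hx, y, hy, rfl⟩
    simp [hk x hx, hk y hy]
  have hle' : vectorSpan ℝ F ≤ LinearMap.ker (l : E →ₗ[ℝ] ℝ) := by
    rw [vectorSpan_def, Submodule.span_le]
    rintro _ ⟨x, hx, y, hy, rfl⟩
    simp [hconst x hx y hy]
  have hker : Module.finrank ℝ (LinearMap.ker (a k)) < Module.finrank ℝ E := by
    refine Submodule.finrank_lt ?_
    rw [Ne, LinearMap.ker_eq_top]
    intro h0
    simpa [h0] using hk x₀ hx₀
  have heq := Submodule.eq_of_le_of_finrank_le hle (by omega)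
  have hsub : x - x₀ ∈ vectorSpan ℝ F := by
    rw [heq]; simp [hx1, hk x₀ hx₀]
  have hlx : l x = l x₀ := by
    have := hle' hsub
    simpa [sub_eq_zero] using this
  exact (hFmem x).2 ⟨hxQ, fun y hy => hlx ▸ ((hFmem x₀).1 hx₀).2 y hy⟩

theorem numFacets_le_card [FiniteDimensional ℝ E] {ι : Type*} [Finite ι]
    {Q : Set E} {a : ι → E →ₗ[ℝ] ℝ} (hQ : ∀ x, x ∈ Q ↔ ∀ k, a k x ≤ 1)
    (hspan : vectorSpan ℝ Q = ⊤) : numFacets Q ≤ Nat.card ι := by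
  have hsub : {F : Set E | IsFacet Q F} ⊆ Set.range fun k => {x ∈ Q | a k x = 1} := by
    intro F hF
    obtain ⟨k, hk⟩ := IsFacet.eq_of_forall_le_one hQ hspan hF
    exact ⟨k, hk.symm⟩
  refine (Set.encard_le_encard hsub).trans ?_
  rw [← Set.image_univ]
  refine (Set.encard_image_le _ _).trans ?_
  rw [Set.encard_univ, ENat.card_eq_coe_natCard]

/-- A supporting hyperplane `{l = 1}` of a full-dimensional polytope is facet-defining when its
contact set spans a complement of a line. -/
theorem isFacet_of_le_one [FiniteDimensional ℝ E] {Q : Set E} (hspan : vectorSpan ℝ Q = ⊤)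
    (l : E →L[ℝ] ℝ) (hle : ∀ x ∈ Q, l x ≤ 1) {p : E} (hpQ : p ∈ Q) (hp1 : l p = 1)
    (hp : vectorSpan ℝ {x ∈ Q | l x = 1} ⊔ Submodule.span ℝ {p} = ⊤) :
    IsFacet Q {x ∈ Q | l x = 1} := by
  refine ⟨⟨p, hpQ, hp1⟩, fun _ => ⟨l, ?_⟩, ?_⟩
  · ext x
    constructor
    · rintro ⟨hx, hx1⟩
      exact ⟨hx, fun y hy => hx1 ▸ hle y hy⟩
    · rintro ⟨hx, hmax⟩
      exact ⟨hx, le_antisymm (hle x hx) (hp1 ▸ hmax p hpQ)⟩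
  · rw [hspan, finrank_top]
    refine finrank_vectorSpan_add_one (l := (l : E →ₗ[ℝ] ℝ)) ?_ (c := 1) (fun x hx => hx.2) p hp
    intro h0
    have : (l : E →ₗ[ℝ] ℝ) p = 1 := hp1
    simp [h0] at this

end Facets

theorem eq_top_of_single_mem {ι : Type*} [Finite ι] [DecidableEq ι] {W : Submodule ℝ (ι → ℝ)}
    (h : ∀ i, Pi.single i (1 : ℝ) ∈ W) : W = ⊤ := by
  cases nonempty_fintype ι
  rw [eq_top_iff]
  intro x _
  rw [pi_eq_sum_univ' x]
  refine Submodule.sum_mem _ fun i _ => W.smul_mem _ ?_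
  convert h i using 1


/-! ### Generators of the two polytopes -/

section Vertices

variable {P : Type*}

theorem signedVec_apply_of_mem {X : Set P} {i : P} (h : i ∈ X) (ε : P → ℤˣ) :
    signedVec X ε i = ((ε i : ℤ) : ℝ) := Set.indicator_of_mem h _

theorem signedVec_apply_of_notMem {X : Set P} {i : P} (h : i ∉ X) (ε : P → ℤˣ) :
    signedVec X ε i = 0 := Set.indicator_of_notMem h _

theorem neg_signedVec (X : Set P) (ε : P → ℤˣ) : -signedVec X ε = signedVec X (-ε) := by
  ext i
  by_cases h : i ∈ X <;> simp [signedVec, h]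

theorem signedVec_sub_update [DecidableEq P] {X : Set P} {i : P} (h : i ∈ X) (ε : P → ℤˣ)
    (hε : ε i = 1) :
    signedVec X ε - signedVec X (Function.update ε i (-1)) = (2 : ℝ) • Pi.single i 1 := by
  ext j
  rcases eq_or_ne j i with rfl | hj
  · simp [signedVec, h, hε]; norm_num
  · by_cases hX : j ∈ X <;> simp [signedVec, hX, hj]

theorem single_mem_vectorSpan [DecidableEq P] {S : Set (P → ℝ)} {x y : P → ℝ} {i : P}
    (hx : x ∈ S) (hy : y ∈ S) (h : x - y = (2 : ℝ) • Pi.single i 1) :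
    Pi.single i (1 : ℝ) ∈ vectorSpan ℝ S := by
  have := Submodule.smul_mem _ (2⁻¹ : ℝ) (vsub_mem_vectorSpan ℝ hx hy)
  rwa [vsub_eq_sub, h, inv_smul_smul₀ two_ne_zero] at this

variable [PartialOrder P]

/-- The generator of the enriched order polytope given by a filter and a choice of signs. -/
noncomputable def orderVec (F : UpperSet P) (ε : P → ℤˣ) : P → ℝ :=
  signedVec (minElts (F : Set P)) ε + signedVec ((F : Set P) \ minElts (F : Set P)) 1

theorem enrichedOrderPolytope_eq :
    enrichedOrderPolytope P = convexHull ℝ {x | ∃ F ε, x = orderVec (P := P) F ε} := rfl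

theorem orderVec_mem (F : UpperSet P) (ε : P → ℤˣ) : orderVec F ε ∈ enrichedOrderPolytope P :=
  subset_convexHull ℝ _ ⟨F, ε, rfl⟩

theorem signedVec_mem {A : Set P} (hA : IsAntichain (· ≤ ·) A) (ε : P → ℤˣ) :
    signedVec A ε ∈ enrichedChainPolytope P :=
  subset_convexHull ℝ _ ⟨A, ε, hA, rfl⟩

theorem orderVec_apply_of_notMem {F : UpperSet P} {i : P} (h : i ∉ F) (ε : P → ℤˣ) :
    orderVec F ε i = 0 := by
  have h' : i ∉ minElts (F : Set P) := fun hi => h hi.1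
  simp [orderVec, signedVec, h', h]

theorem orderVec_apply_of_minimal {F : UpperSet P} {i : P} (h : i ∈ minElts (F : Set P))
    (ε : P → ℤˣ) : orderVec F ε i = ((ε i : ℤ) : ℝ) := by
  simp [orderVec, signedVec, h]

theorem orderVec_apply_of_not_minimal {F : UpperSet P} {i : P} (hi : i ∈ F)
    (h : i ∉ minElts (F : Set P)) (ε : P → ℤˣ) : orderVec F ε i = 1 := by
  simp [orderVec, signedVec, h, hi]

theorem orderVec_apply_of_lt {F : UpperSet P} {i j : P} (hi : i ∈ F) (hij : i < j)
    (ε : P → ℤˣ) : orderVec F ε j = 1 :=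
  orderVec_apply_of_not_minimal (F.upper hij.le hi) (fun h => (h.not_lt hi) hij) ε

theorem orderVec_abs_le (F : UpperSet P) (ε : P → ℤˣ) (i : P) :
    -1 ≤ orderVec F ε i ∧ orderVec F ε i ≤ 1 := by
  by_cases hi : i ∈ F
  · by_cases h : i ∈ minElts (F : Set P)
    · rw [orderVec_apply_of_minimal h]
      rcases Int.units_eq_one_or (ε i) with h | h <;> simp [h]
    · rw [orderVec_apply_of_not_minimal hi h]; norm_num
  · rw [orderVec_apply_of_notMem hi]; norm_num

theorem orderVec_sub_update [DecidableEq P] {F : UpperSet P} {i : P}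
    (h : i ∈ minElts (F : Set P)) :
    orderVec F 1 - orderVec F (Function.update 1 i (-1)) = (2 : ℝ) • Pi.single i 1 := by
  rw [orderVec, orderVec, add_sub_add_right_eq_sub, signedVec_sub_update h 1 rfl]

theorem minElts_Ici (i : P) : minElts ((UpperSet.Ici i : UpperSet P) : Set P) = {i} := by
  ext j
  simp only [minElts, UpperSet.coe_Ici, Set.mem_ofPred_eq, Set.mem_singleton_iff, Set.mem_Ici]
  constructor
  · intro h
    exact (h.eq_of_ge (y := i) le_rfl h.1)
  · rintro rfl
    exact ⟨le_rfl, fun y hy _ => hy⟩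

theorem vectorSpan_enrichedOrderPolytope [Finite P] :
    vectorSpan ℝ (enrichedOrderPolytope P) = ⊤ := by
  classical
  refine eq_top_of_single_mem fun i => single_mem_vectorSpan (orderVec_mem (UpperSet.Ici i) _)
    (orderVec_mem _ _) (orderVec_sub_update ?_)
  rw [minElts_Ici]; rfl

theorem vectorSpan_enrichedChainPolytope [Finite P] :
    vectorSpan ℝ (enrichedChainPolytope P) = ⊤ := by
  classical
  have h : ∀ i : P, IsAntichain (· ≤ ·) ({i} : Set P) := 
    fun i => Set.subsingleton_singleton.isAntichain _
  exact eq_top_of_single_mem fun i => single_mem_vectorSpan (signedVec_mem (h i) _)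
    (signedVec_mem (h i) _) (signedVec_sub_update (Set.mem_singleton i) 1 rfl)

theorem neg_enrichedChainPolytope : -enrichedChainPolytope P = enrichedChainPolytope P := by
  rw [enrichedChainPolytope, ← convexHull_neg]
  congr 1
  ext x
  simp only [Set.mem_neg, Set.mem_ofPred_eq]
  constructor
  · rintro ⟨A, ε, hA, h⟩
    exact ⟨A, -ε, hA, by rw [← neg_signedVec, ← h, neg_neg]⟩
  · rintro ⟨A, ε, hA, h⟩
    exact ⟨A, -ε, hA, by rw [← neg_signedVec, ← h]⟩

/-- With no strict relations every subset is at once a filter, an antichain and its own set of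
minimal elements, so the generators agree. -/
theorem enrichedOrderPolytope_eq_of_isAntichain (h : IsAntichain (· ≤ ·) (Set.univ : Set P)) :
    enrichedOrderPolytope P = enrichedChainPolytope P := by
  have hle : ∀ {i j : P}, i ≤ j → i = j := fun {i j} hij => h.eq trivial trivial hij
  have hmin : ∀ F : Set P, minElts F = F := by
    intro F
    ext i
    exact ⟨fun hi => hi.1, fun hi => ⟨hi, fun j _ hj => (hle hj).ge⟩⟩
  rw [enrichedOrderPolytope, enrichedChainPolytope]
  congr 1
  ext x
  simp only [Set.mem_ofPred_eq, hmin]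
  constructor
  · rintro ⟨F, ε, rfl⟩
    exact ⟨F, ε, h.subset (Set.subset_univ _), by ext; simp [signedVec]⟩
  · rintro ⟨A, ε, hA, rfl⟩
    exact ⟨⟨A, fun i j hij hi => hle hij ▸ hi⟩, ε, by ext; simp [signedVec]; rfl⟩

end Vertices

/-! ### Central symmetry forces an antichain -/

section Symmetry

variable {P : Type*} [PartialOrder P]

/-- For `k < m` with `m` maximal, the vertex of the filter generated by `k`, with positive signs,
lies on the facet `x m = 1`. Its negative violates a valid inequality. -/
theorem isAntichain_of_isCentrallySymmetric [Finite P]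
    (h : IsCentrallySymmetric (enrichedOrderPolytope P)) :
    IsAntichain (· ≤ ·) (Set.univ : Set P) := by
  classical
  intro k _ j _ hkj hle
  obtain ⟨m, hjm, hm⟩ := Finite.exists_le_maximal (p := fun _ : P => True) (a := j) trivial
  have hmax : ∀ {a}, m ≤ a → a = m := fun {a} ha => le_antisymm (hm.2 trivial ha) ha
  have hkm : k < m := lt_of_lt_of_le (lt_of_le_of_ne hle hkj) hjm
  let l : (P → ℝ) →L[ℝ] ℝ := ContinuousLinearMap.proj m
  have hl : ∀ x, l x = x m := fun _ => rfl
  have hpmin : m ∈ minElts ((UpperSet.Ici m : UpperSet P) : Set P) := by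
    rw [minElts_Ici]; rfl
  have hp : orderVec (UpperSet.Ici m) 1 = Pi.single m (1 : ℝ) := by
    ext a
    rcases eq_or_ne a m with rfl | ha
    · simp [orderVec_apply_of_minimal hpmin]
    · rw [orderVec_apply_of_notMem, Pi.single_eq_of_ne ha]
      exact fun hma => ha (hmax hma)
  have hface : IsFacet (enrichedOrderPolytope P) {x ∈ enrichedOrderPolytope P | l x = 1} := by
    refine isFacet_of_le_one vectorSpan_enrichedOrderPolytope l (fun x hx => ?_)
      (orderVec_mem (UpperSet.Ici m) 1) (by simp [hp, hl]) ?_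
    · refine convexHull_min (s := {x | ∃ F ε, x = orderVec (P := P) F ε}) (t := {x | l x ≤ 1}) ?_
        (convex_halfSpace_le l.isLinear 1) hx
      rintro _ ⟨F, ε, rfl⟩
      exact (orderVec_abs_le F ε m).2
    · refine eq_top_of_single_mem fun i => ?_
      rcases eq_or_ne i m with rfl | him
      · rw [hp]
        exact Submodule.mem_sup_right (Submodule.mem_span_singleton_self _)
      · refine Submodule.mem_sup_left ?_
        -- The order on `UpperSet` is reverse inclusion, so `⊓` is the union: the filter generated
        -- by `i` and `m`. Since `m` is maximal and `i ≠ m`, `i` is minimal in it, and flipping the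
        -- sign at `i` moves along `e i` inside the face.
        let F : UpperSet P := UpperSet.Ici i ⊓ UpperSet.Ici m
        have hF : ∀ a, a ∈ F ↔ i ≤ a ∨ m ≤ a := fun a => Iff.rfl
        have hiF : i ∈ minElts (F : Set P) := by
          refine ⟨(hF i).2 (Or.inl le_rfl), fun a ha hai => ?_⟩
          rcases (hF a).1 ha with ha | ha
          · exact ha
          · exact absurd (hmax (ha.trans hai)) him
        have hval : ∀ ε : P → ℤˣ, ε m = 1 → orderVec F ε m = 1 := by
          intro ε hε
          by_cases hmF : m ∈ minElts (F : Set P)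
          · simp [orderVec_apply_of_minimal hmF, hε]
          · exact orderVec_apply_of_not_minimal ((hF m).2 (Or.inr le_rfl)) hmF ε
        exact single_mem_vectorSpan ⟨orderVec_mem F _, hval _ rfl⟩
          ⟨orderVec_mem F _, hval _ (by simp [him.symm])⟩ (orderVec_sub_update hiF)
  have hneg : -{x ∈ enrichedOrderPolytope P | l x = 1} ⊆ enrichedOrderPolytope P := by
    obtain ⟨hne, hexp, -⟩ := h _ hface
    exact hexp.subset
  have hkmin : k ∈ minElts ((UpperSet.Ici k : UpperSet P) : Set P) := by
    rw [minElts_Ici]; rfl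
  have hmem : -orderVec (UpperSet.Ici k) 1 ∈ enrichedOrderPolytope P := by
    refine hneg ?_
    rw [Set.neg_mem_neg]
    exact ⟨orderVec_mem _ _, orderVec_apply_of_lt (i := k) (UpperSet.mem_Ici_iff.2 le_rfl) hkm 1⟩
  -- On generators `-2 x k - x m ≤ 1`: if `k ∈ F` then `x m = 1` and `x k ≥ -1`; otherwise `x k = 0`
  -- and `x m ≥ -1`. The negated vertex, with both coordinates `-1`, gives `3`.
  let g : (P → ℝ) →L[ℝ] ℝ := (-2 : ℝ) • ContinuousLinearMap.proj k - ContinuousLinearMap.proj m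
  have hg : ∀ x, g x = -2 * x k - x m := fun _ => rfl
  have hle : g (-orderVec (UpperSet.Ici k) 1) ≤ 1 := by
    refine convexHull_min (s := {x | ∃ F ε, x = orderVec (P := P) F ε}) (t := {x | g x ≤ 1}) ?_
      (convex_halfSpace_le g.isLinear 1) hmem
    rintro _ ⟨F, ε, rfl⟩
    rw [Set.mem_ofPred_eq, hg]
    by_cases hkF : k ∈ F
    · rw [orderVec_apply_of_lt hkF hkm]
      linarith [(orderVec_abs_le F ε k).1]
    · rw [orderVec_apply_of_notMem hkF]
      linarith [(orderVec_abs_le F ε m).1]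
  rw [hg, Pi.neg_apply, Pi.neg_apply, orderVec_apply_of_minimal hkmin,
    orderVec_apply_of_lt (i := k) (UpperSet.mem_Ici_iff.2 le_rfl) hkm 1] at hle
  norm_num at hle

end Symmetry

/-! ### A lower bound for the facets of the enriched chain polytope -/

section ChainFacets

variable {P : Type*}

/-- The linear functional `x ↦ ∑ i ∈ C, ε i * x i`. -/
noncomputable def signedSum (C : Finset P) (ε : P → ℤˣ) : (P → ℝ) →L[ℝ] ℝ :=
  ∑ i ∈ C, ((ε i : ℤ) : ℝ) • ContinuousLinearMap.proj i

theorem signedSum_apply (C : Finset P) (ε : P → ℤˣ) (x : P → ℝ) :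
    signedSum C ε x = ∑ i ∈ C, ((ε i : ℤ) : ℝ) * x i := by
  simp [signedSum]

theorem signedSum_signedVec_singleton [DecidableEq P] (C : Finset P) (ε δ : P → ℤˣ) (i : P) :
    signedSum C ε (signedVec {i} δ) = 1 ↔ i ∈ C ∧ ε i = δ i := by
  have : ∀ j ∈ C, ((ε j : ℤ) : ℝ) * signedVec {i} δ j =
      if j = i then ((ε i : ℤ) : ℝ) * ((δ i : ℤ) : ℝ) else 0 := by
    intro j _
    rcases eq_or_ne j i with rfl | h <;> simp [signedVec, *]
  rw [signedSum_apply, Finset.sum_congr rfl this, Finset.sum_ite_eq']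
  rcases Int.units_eq_one_or (ε i) with h | h <;>
    rcases Int.units_eq_one_or (δ i) with h' | h' <;> simp [h, h'] <;>
    split_ifs <;> norm_num

variable [PartialOrder P]

/-- A chain meets an antichain in at most one element, so on a generator at most one term of the sum
is nonzero. -/
theorem signedSum_le_one {C : Finset P} (hC : IsChain (· ≤ ·) (C : Set P)) (ε : P → ℤˣ)
    {x : P → ℝ} (hx : x ∈ enrichedChainPolytope P) : signedSum C ε x ≤ 1 := by
  refine convexHull_min (t := {x | signedSum C ε x ≤ 1}) ?_
    (convex_halfSpace_le (signedSum C ε).isLinear 1) hx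
  rintro _ ⟨A, δ, hA, rfl⟩
  rw [Set.mem_ofPred_eq, signedSum_apply]
  by_cases h : ∃ i ∈ C, i ∈ A
  · obtain ⟨i, hiC, hiA⟩ := h
    rw [Finset.sum_eq_single_of_mem i hiC, signedVec_apply_of_mem hiA]
    · rcases Int.units_eq_one_or (ε i) with h | h <;>
        rcases Int.units_eq_one_or (δ i) with h' | h' <;> simp [h, h']
    · intro j hj hji
      rw [signedVec_apply_of_notMem, mul_zero]
      intro hjA
      rcases hC hj hiC hji with hle | hle
      · exact hA hjA hiA hji hle
      · exact hA hiA hjA hji.symm hle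
  · push Not at h
    rw [Finset.sum_eq_zero]
    · exact zero_le_one
    · intro i hi
      rw [signedVec_apply_of_notMem (h i hi), mul_zero]

/-- The contact set contains `ε j • e j` for `j ∈ C`. For `j ∉ C`, maximality gives some `i ∈ C`
incomparable to `j`, and both points `ε i • e i ± e j` lie on the hyperplane, which supplies the
direction `e j`. -/
theorem isFacet_signedSum [Finite P] [Nonempty P] {C : Finset P}
    (hC : IsMaxChain (· ≤ ·) (C : Set P)) (ε : P → ℤˣ) :
    IsFacet (enrichedChainPolytope P) {x ∈ enrichedChainPolytope P | signedSum C ε x = 1} := by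
  classical
  have hinc : ∀ j ∉ C, ∃ i ∈ C, ¬ i ≤ j ∧ ¬ j ≤ i := by
    intro j hj
    by_contra! hcon
    have := hC.2 (hC.1.insert (a := j) fun b hb _ => by
      by_cases h : b ≤ j
      · exact Or.inr h
      · exact Or.inl (hcon b hb h)) (Set.subset_insert _ _)
    exact hj (by rw [← Finset.mem_coe, this]; exact Set.mem_insert _ _)
  have hsing : ∀ i : P, IsAntichain (· ≤ ·) ({i} : Set P) :=
    fun i => Set.subsingleton_singleton.isAntichain _
  have hmem : ∀ i ∈ C, signedVec {i} ε ∈ {x ∈ enrichedChainPolytope P | signedSum C ε x = 1} :=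
    fun i hi => ⟨signedVec_mem (hsing i) ε, (signedSum_signedVec_singleton C ε ε i).2 ⟨hi, rfl⟩⟩
  obtain ⟨i₀, hi₀⟩ : C.Nonempty := by
    rw [Finset.nonempty_iff_ne_empty]
    rintro rfl
    obtain ⟨j⟩ := ‹Nonempty P›
    obtain ⟨i, hi, -⟩ := hinc j (by simp)
    simp at hi
  refine isFacet_of_le_one vectorSpan_enrichedChainPolytope _ (fun x hx => signedSum_le_one hC.1 ε hx)
    (hmem i₀ hi₀).1 (hmem i₀ hi₀).2 (eq_top_of_single_mem fun j => ?_)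
  by_cases hj : j ∈ C
  · have h1 : signedVec {j} ε ∈ vectorSpan ℝ {x ∈ enrichedChainPolytope P | signedSum C ε x = 1} ⊔
        Submodule.span ℝ {signedVec {i₀} ε} := by
      have := Submodule.add_mem_sup (vsub_mem_vectorSpan ℝ (hmem j hj) (hmem i₀ hi₀))
        (Submodule.mem_span_singleton_self (R := ℝ) (signedVec {i₀} ε))
      simpa using this
    have h2 : Pi.single j (1 : ℝ) = ((ε j : ℤ) : ℝ) • signedVec {j} ε := by
      ext a
      rcases eq_or_ne a j with rfl | ha
      · rcases Int.units_eq_one_or (ε a) with h | h <;> simp [signedVec, h]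
      · simp [signedVec, ha]
    rw [h2]
    exact Submodule.smul_mem _ _ h1
  · refine Submodule.mem_sup_left ?_
    obtain ⟨i, hi, hij, hji⟩ := hinc j hj
    have hanti : IsAntichain (· ≤ ·) ({i, j} : Set P) := by
      intro a ha b hb hab hle
      rcases ha with rfl | rfl <;> rcases hb with rfl | rfl <;> simp_all
    have hne : i ≠ j := by rintro rfl; exact hij le_rfl
    have hval : ∀ u, signedVec {i, j} (Function.update ε j u) ∈
        {x ∈ enrichedChainPolytope P | signedSum C ε x = 1} := by
      intro u
      refine ⟨signedVec_mem hanti _, ?_⟩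
      rw [← (hmem i hi).2, signedSum_apply, signedSum_apply]
      refine Finset.sum_congr rfl fun a ha => ?_
      have haj : a ≠ j := by rintro rfl; exact hj ha
      by_cases hai : a = i <;> simp [signedVec, hai, haj, hne]
    refine single_mem_vectorSpan (hval 1) (hval (-1)) ?_
    have := signedVec_sub_update (X := {i, j}) (i := j) (by simp) (Function.update ε j 1) (by simp)
    rwa [Function.update_idem] at this

/-- Maximal chains of `P`, as finite sets. -/
abbrev MaxChains (P : Type*) [PartialOrder P] : Type _ :=
  {C : Finset P // IsMaxChain (· ≤ ·) (C : Set P)}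

/-- The points `± e i` lying on such a facet recover both the chain and its signs, so distinct data
give distinct facets. -/
theorem card_le_numFacets_enrichedChainPolytope [Finite P] [Nonempty P] :
    (Nat.card (Σ C : MaxChains P, (C.1 → ℤˣ)) : ℕ∞) ≤ numFacets (enrichedChainPolytope P) := by
  classical
  -- The value `1` off the chain is immaterial: `signedSum` reads signs only on `C`.
  let ext : (Σ C : MaxChains P, (C.1 → ℤˣ)) → P → ℤˣ :=
    fun s i => if h : i ∈ s.1.1 then s.2 ⟨i, h⟩ else 1
  let f : (Σ C : MaxChains P, (C.1 → ℤˣ)) → Set (P → ℝ) :=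
    fun s => {x ∈ enrichedChainPolytope P | signedSum s.1.1 (ext s) x = 1}
  have hmem : ∀ s i u, signedVec {i} (fun _ => u) ∈ f s ↔ ∃ h : i ∈ s.1.1, s.2 ⟨i, h⟩ = u := by
    intro s i u
    have h1 : signedVec {i} (fun _ => u) ∈ enrichedChainPolytope P :=
      signedVec_mem (Set.subsingleton_singleton.isAntichain _) _
    simp only [f, Set.mem_ofPred_eq, h1, true_and, signedSum_signedVec_singleton, ext]
    constructor
    · rintro ⟨h, hu⟩
      exact ⟨h, by simpa [h] using hu⟩
    · rintro ⟨h, hu⟩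
      exact ⟨h, by simpa [h] using hu⟩
  have hinj : Function.Injective f := by
    rintro ⟨⟨C, hC⟩, ε⟩ ⟨⟨D, hD⟩, δ⟩ h
    have key : ∀ i u, (∃ h : i ∈ C, ε ⟨i, h⟩ = u) ↔ ∃ h : i ∈ D, δ ⟨i, h⟩ = u := by
      intro i u
      rw [← hmem ⟨⟨C, hC⟩, ε⟩, ← hmem ⟨⟨D, hD⟩, δ⟩, h]
    obtain rfl : C = D := by
      ext i
      exact ⟨fun hi => ((key i _).1 ⟨hi, rfl⟩).1, fun hi => ((key i _).2 ⟨hi, rfl⟩).1⟩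
    obtain rfl : ε = δ := by
      funext i
      obtain ⟨_, h⟩ := (key i.1 _).1 ⟨i.2, rfl⟩
      exact h.symm
    rfl
  rw [← ENat.card_eq_coe_natCard, ← Set.encard_univ, ← hinj.encard_image]
  refine Set.encard_le_encard ?_
  rintro _ ⟨s, -, rfl⟩
  exact isFacet_signedSum s.1.2 _

end ChainFacets

/-! ### Points of the order polytope as integrals of vertices -/

section LayerCake

open MeasureTheory

variable {P : Type*} [PartialOrder P]

theorem integral_Ioc_ite_lt {s : ℝ} (h0 : 0 ≤ s) (h1 : s ≤ 1) :
    ∫ t in Set.Ioc (0 : ℝ) 1, (if t < s then (1 : ℝ) else 0) = s := by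
  have h : (fun t => if t < s then (1 : ℝ) else 0) = (Set.Iio s).indicator 1 := by
    ext; simp [Set.indicator]
  have h' : Set.Iio s ∩ Set.Ioc 0 1 = Set.Ioo 0 s := by ext; simp; grind
  rw [h, integral_indicator_one measurableSet_Iio, Measure.real,
    Measure.restrict_apply measurableSet_Iio]
  simp [h', h0]

theorem integrableOn_Ioc_ite_lt (s : ℝ) :
    IntegrableOn (fun t => if t < s then (1 : ℝ) else 0) (Set.Ioc 0 1) := by
  refine Integrable.of_bound ?_ 1 (Filter.Eventually.of_forall fun t => ?_)
  · exact (Measurable.ite measurableSet_Iio measurable_const measurable_const).aestronglyMeasurable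
  · split_ifs <;> simp

theorem isClosed_enrichedOrderPolytope [Finite P] : IsClosed (enrichedOrderPolytope P) := by
  classical
  have : Finite (UpperSet P) := Finite.of_injective (fun F : UpperSet P => (F : Set P))
    SetLike.coe_injective
  rw [enrichedOrderPolytope_eq]
  refine Set.Finite.isClosed_convexHull ℝ ?_
  refine (Set.finite_range fun s : UpperSet P × (P → ℤˣ) => orderVec s.1 s.2).subset ?_
  rintro _ ⟨F, ε, rfl⟩
  exact ⟨(F, ε), rfl⟩

/-- Layer-cake argument: for each level `t` the indicators of `t < S i` and `t < T i` combine to a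
vertex, and integrating over `t ∈ (0, 1]` returns `2 S - T`. A closed convex set contains such
averages. -/
theorem mem_enrichedOrderPolytope_of_interlacing [Finite P] {S T : P → ℝ}
    (hST : ∀ i, S i ≤ T i) (hTS : ∀ i j, i < j → T i ≤ S j) (h0 : ∀ i, 0 ≤ S i)
    (h1 : ∀ i, T i ≤ 1) :
    (fun i => 2 * S i - T i) ∈ enrichedOrderPolytope P := by
  classical
  cases nonempty_fintype P
  let v : ℝ → P → ℝ := fun t i => 2 * (if t < S i then 1 else 0) - if t < T i then 1 else 0
  have hv : ∀ t, v t ∈ enrichedOrderPolytope P := by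
    intro t
    let G : UpperSet P := ⟨{i | t < T i}, fun i j hij (hi : t < T i) => by
      rcases hij.eq_or_lt with rfl | hlt
      · exact hi
      · exact hi.trans_le ((hTS i j hlt).trans (hST j))⟩
    have hG : ∀ i, i ∈ G ↔ t < T i := fun i => Iff.rfl
    convert orderVec_mem G (fun i => if t < S i then 1 else -1) using 1
    ext i
    by_cases hi : i ∈ G
    · by_cases hm : i ∈ minElts (G : Set P)
      · rw [orderVec_apply_of_minimal hm]
        simp only [v, (hG i).1 hi, if_true]
        split_ifs <;> norm_num
      · rw [orderVec_apply_of_not_minimal hi hm]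
        -- A non-minimal `i` has some `j < i` in `G`, and then `t < T j ≤ S i`; so the value `-1`
        -- occurs only at minimal elements.
        have hS : t < S i := by
          by_contra hS
          refine hm ⟨hi, fun j hj hji => ?_⟩
          by_contra hij
          exact hS (((hG j).1 hj).trans_le (hTS j i (lt_of_le_not_ge hji hij)))
        simp only [v, (hG i).1 hi, hS, if_true]
        norm_num
    · rw [orderVec_apply_of_notMem hi]
      have hT : ¬ t < T i := hi
      have hS : ¬ t < S i := fun h => hT (h.trans_le (hST i))
      simp [v, hT, hS]
  have hint : ∀ i, IntegrableOn (fun t => v t i) (Set.Ioc 0 1) := fun i =>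
    ((integrableOn_Ioc_ite_lt (S i)).const_mul 2).sub (integrableOn_Ioc_ite_lt (T i))
  have : IsProbabilityMeasure (volume.restrict (Set.Ioc (0 : ℝ) 1)) := ⟨by simp⟩
  have hmem : (∫ t in Set.Ioc (0 : ℝ) 1, v t) ∈ enrichedOrderPolytope P :=
    (convex_convexHull ℝ _).integral_mem (isClosed_enrichedOrderPolytope (P := P))
    (μ := volume.restrict (Set.Ioc (0 : ℝ) 1)) (Filter.Eventually.of_forall hv)
    (Integrable.of_eval hint)
  convert hmem using 1
  ext i
  rw [eval_integral hint]
  simp only [v]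
  rw [integral_sub ((integrableOn_Ioc_ite_lt (S i)).const_mul 2) (integrableOn_Ioc_ite_lt (T i)),
    integral_const_mul, integral_Ioc_ite_lt (h0 i) ((hST i).trans (h1 i)),
    integral_Ioc_ite_lt ((h0 i).trans (hST i)) (h1 i)]

end LayerCake

/-! ### Half-space description of the enriched order polytope and the facet count -/

section HalfSpaces

variable {P : Type*} [PartialOrder P]

theorem finset_chain_induction {p : Finset P → Prop} [DecidableEq P] (h0 : p ∅)
    (h1 : ∀ m D, (∀ j ∈ D, m < j) → p D → p (insert m D)) (D : Finset P)
    (hD : IsChain (· ≤ ·) (D : Set P)) : p D := by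
  induction D using Finset.strongInduction with
  | H D ih =>
    rcases D.eq_empty_or_nonempty with rfl | hne
    · exact h0
    · obtain ⟨m, hm⟩ := Finset.exists_minimal hne
      rw [← Finset.insert_erase hm.1]
      refine h1 m _ (fun j hj => ?_) (ih _ (Finset.erase_ssubset hm.1)
        (hD.mono (Finset.coe_subset.2 (Finset.erase_subset _ _))))
      obtain ⟨hjm, hj⟩ := Finset.mem_erase.1 hj
      rcases hD hm.1 hj hjm.symm with h | h
      · exact lt_of_le_of_ne h hjm.symm
      · exact absurd (hm.eq_of_le hj h) hjm

open Classical in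
/-- The elements of `C` above `i`. -/
noncomputable def above (C : Finset P) (i : P) : Finset P := C.filter (i < ·)

theorem mem_above {C : Finset P} {i j : P} : j ∈ above C i ↔ j ∈ C ∧ i < j := by
  simp [above]

/-- The linear functional `x ↦ ∑ j ∈ D, 2 ^ #{k ∈ D | j < k} * x j`. -/
noncomputable def chainSum (D : Finset P) : (P → ℝ) →ₗ[ℝ] ℝ :=
  ∑ j ∈ D, (2 : ℝ) ^ (above D j).card • LinearMap.proj j

theorem chainSum_apply (D : Finset P) (x : P → ℝ) :
    chainSum D x = ∑ j ∈ D, (2 : ℝ) ^ (above D j).card * x j := by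
  simp [chainSum]

theorem chainSum_insert [DecidableEq P] {m : P} {D : Finset P} (h : ∀ j ∈ D, m < j) (x : P → ℝ) :
    chainSum (insert m D) x = 2 ^ D.card * x m + chainSum D x := by
  have hm : m ∉ D := fun hm => (h m hm).false
  rw [chainSum_apply, chainSum_apply, Finset.sum_insert hm]
  congr 1
  · congr 3
    ext j
    simp only [mem_above, Finset.mem_insert]
    constructor
    · rintro ⟨rfl | hj, hlt⟩
      · exact absurd hlt (lt_irrefl _)
      · exact hj
    · exact fun hj => ⟨Or.inr hj, h j hj⟩
  · refine Finset.sum_congr rfl fun j hj => ?_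
    congr 3
    ext k
    simp only [mem_above, Finset.mem_insert]
    constructor
    · rintro ⟨rfl | hk, hlt⟩
      · exact absurd (hlt.trans (h j hj)) (lt_irrefl _)
      · exact ⟨hk, hlt⟩
    · exact fun hk => ⟨Or.inr hk.1, hk.2⟩

/-- Going up a chain, a generator reads zeros, then one entry `± 1`, then only ones. Ones above the
new minimum `m` bring the total to `2 ^ #D`, exactly enough to absorb `2 ^ #D * x m` when `x m =
-1`. -/
theorem one_add_chainSum_orderVec (F : UpperSet P) (ε : P → ℤˣ) {D : Finset P}
    (hD : IsChain (· ≤ ·) (D : Set P)) :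
    0 ≤ 1 + chainSum D (orderVec F ε) ∧
      ((∀ j ∈ D, orderVec F ε j = 1) → 1 + chainSum D (orderVec F ε) = 2 ^ D.card) := by
  classical
  refine finset_chain_induction (p := fun D => 0 ≤ 1 + chainSum D (orderVec F ε) ∧
    ((∀ j ∈ D, orderVec F ε j = 1) → 1 + chainSum D (orderVec F ε) = 2 ^ D.card))
    ?_ (fun m D h ih => ?_) D hD
  · simp [chainSum]
  · have hm : m ∉ D := fun hm => (h m hm).false
    rw [chainSum_insert h]
    constructor
    · by_cases hmF : m ∈ F
      · have := ih.2 fun j hj => orderVec_apply_of_lt hmF (h j hj) ε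
        have h2 : (0 : ℝ) < 2 ^ D.card := by positivity
        nlinarith [(orderVec_abs_le F ε m).1]
      · rw [orderVec_apply_of_notMem hmF]
        linarith [ih.1]
    · intro hall
      have := ih.2 fun j hj => hall j (Finset.mem_insert_of_mem hj)
      rw [hall m (Finset.mem_insert_self _ _), Finset.card_insert_of_notMem hm, pow_succ]
      linarith

/-- The left-hand sides of the inequalities `_ ≤ 1` cutting out the enriched order polytope. -/
noncomputable def orderFunctional (s : Σ C : MaxChains P, Option C.1) : (P → ℝ) →ₗ[ℝ] ℝ :=
  match s with
  | ⟨C, none⟩ => -chainSum C.1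
  | ⟨C, some i⟩ =>
    (2 : ℝ) ^ (above C.1 i.1).card • LinearMap.proj i.1 - chainSum (above C.1 i.1)

theorem isChain_above {C : Finset P} (hC : IsChain (· ≤ ·) (C : Set P)) (i : P) :
    IsChain (· ≤ ·) (above C i : Set P) :=
  hC.mono fun _ hj => (mem_above.1 hj).1

theorem orderFunctional_le_one (s : Σ C : MaxChains P, Option C.1) {x : P → ℝ}
    (hx : x ∈ enrichedOrderPolytope P) : orderFunctional s x ≤ 1 := by
  refine convexHull_min (s := {x | ∃ F ε, x = orderVec (P := P) F ε})
    (t := {x | orderFunctional s x ≤ 1}) ?_ (convex_halfSpace_le (orderFunctional s).isLinear 1) hx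
  rintro _ ⟨F, ε, rfl⟩
  obtain ⟨C, _ | i⟩ := s
  · have := (one_add_chainSum_orderVec F ε C.2.1).1
    simp only [Set.mem_ofPred_eq, orderFunctional, LinearMap.neg_apply]
    linarith
  · have h := one_add_chainSum_orderVec F ε (isChain_above C.2.1 i.1)
    simp only [Set.mem_ofPred_eq, orderFunctional, LinearMap.sub_apply, LinearMap.smul_apply,
      LinearMap.proj_apply, smul_eq_mul]
    by_cases hi : i.1 ∈ F
    · have := h.2 fun j hj => orderVec_apply_of_lt hi (mem_above.1 hj).2 ε
      have h2 : (0 : ℝ) < 2 ^ (above C.1 i.1).card := by positivity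
      nlinarith [(orderVec_abs_le F ε i.1).2]
    · rw [orderVec_apply_of_notMem hi]
      linarith [h.1]

theorem exists_maxChain_superset [Finite P] {c : Set P} (hc : IsChain (· ≤ ·) c) :
    ∃ C : MaxChains P, c ⊆ (C.1 : Set P) := by
  obtain ⟨M, hM, hcM⟩ := hc.exists_maxChain
  exact ⟨⟨(Set.toFinite M).toFinset, by simpa using hM⟩, by simpa using hcM⟩

/-- A maximal chain through the upper end of a covering relation can be rerouted through its
lower end. -/
theorem exists_maxChain_above_eq_insert [Finite P] [DecidableEq P] {i j : P} (hij : i ⋖ j)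
    (C : MaxChains P) (hj : j ∈ C.1) :
    ∃ C' : MaxChains P, i ∈ C'.1 ∧ above C'.1 i = insert j (above C.1 j) := by
  have hchain : IsChain (· ≤ ·) (insert i (insert j (above C.1 j)) : Set P) := by
    refine IsChain.insert ?_ fun b hb _ => Or.inl ?_
    · exact (isChain_above C.2.1 j).insert fun b hb _ => Or.inl (mem_above.1 hb).2.le
    · rcases hb with rfl | hb
      · exact hij.le
      · exact hij.le.trans (mem_above.1 hb).2.le
  obtain ⟨C', hC'⟩ := exists_maxChain_superset hchain
  have hiC' : i ∈ C'.1 := hC' (by simp)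
  have hjC' : j ∈ C'.1 := hC' (by simp)
  have hsub : ∀ k ∈ above C.1 j, k ∈ C'.1 := fun k hk =>
    hC' (Set.mem_insert_of_mem _ (Set.mem_insert_of_mem _ hk))
  refine ⟨C', hiC', ?_⟩
  ext k
  rw [mem_above, Finset.mem_insert]
  constructor
  -- The covering relation rules out elements strictly between `i` and `j`. An element of `C'` above
  -- `j` is comparable to all of `C`, hence belongs to `C` by maximality.
  · rintro ⟨hk, hik⟩
    refine or_iff_not_imp_left.2 fun hkj => ?_
    have hjk : j < k := by
      rcases C'.2.1 hk hjC' hkj with h | h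
      · exact absurd (lt_of_le_of_ne h hkj) (hij.2 hik)
      · exact lt_of_le_of_ne h (Ne.symm hkj)
    refine mem_above.2 ⟨?_, hjk⟩
    have hins : IsChain (· ≤ ·) (insert k (C.1 : Set P)) := by
      refine C.2.1.insert fun b hb hkb => ?_
      by_cases hbj : b ≤ j
      · exact Or.inr (hbj.trans hjk.le)
      · have hjb : j < b := by
          have hne : b ≠ j := by rintro rfl; exact hbj le_rfl
          rcases C.2.1 hb hj hne with h | h
          · exact absurd h hbj
          · exact lt_of_le_of_ne h hne.symm
        exact C'.2.1 hk (hsub b (mem_above.2 ⟨hb, hjb⟩)) hkb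
    rw [← Finset.mem_coe, C.2.2 hins (Set.subset_insert _ _)]
    exact Set.mem_insert _ _
  · rintro (rfl | hk)
    · exact ⟨hjC', hij.lt⟩
    · exact ⟨hsub k hk, hij.lt.trans (mem_above.1 hk).2⟩

/-- The interlacing pair is built from the top: `T = 1` at maximal elements, `S = (T + x) / 2`, and
`T i` is to be at most every `S j` with `j` covering `i`. The `some` inequalities give `S ≤ T`; the
`none` inequalities give `S ≥ 0` at minimal elements. -/
theorem mem_enrichedOrderPolytope_of_orderFunctional_le_one [Finite P] {x : P → ℝ}
    (hx : ∀ s, orderFunctional s x ≤ 1) : x ∈ enrichedOrderPolytope P := by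
  classical
  -- The value at `i` obtained by unrolling `T i = (T j + x j) / 2` along `C` from `1` at its top;
  -- `T i` is its minimum over maximal chains through `i`.
  let τ : MaxChains P → P → ℝ := fun C i =>
    (1 + chainSum (above C.1 i) x) / 2 ^ (above C.1 i).card
  have hpow : ∀ n : ℕ, (0 : ℝ) < 2 ^ n := fun n => by positivity
  have hτ : ∀ i, ∃ C : MaxChains P, i ∈ C.1 ∧ ∀ C' : MaxChains P, i ∈ C'.1 → τ C i ≤ τ C' i := by
    intro i
    obtain ⟨C₀, hC₀⟩ := exists_maxChain_superset (Set.subsingleton_singleton (a := i)).isChain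
    have : Nonempty {C : MaxChains P // i ∈ C.1} := ⟨⟨C₀, hC₀ rfl⟩⟩
    obtain ⟨C, hC⟩ := Finite.exists_min fun C : {C : MaxChains P // i ∈ C.1} => τ C.1 i
    exact ⟨C.1, C.2, fun C' hC' => hC ⟨C', hC'⟩⟩
  choose D hD hDmin using hτ
  let T : P → ℝ := fun i => τ (D i) i
  let S : P → ℝ := fun i => (T i + x i) / 2
  have hxT : ∀ i, x i ≤ T i := by
    intro i
    have := hx ⟨D i, some ⟨i, hD i⟩⟩
    simp only [orderFunctional, LinearMap.sub_apply, LinearMap.smul_apply,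
      LinearMap.proj_apply, smul_eq_mul] at this
    simp only [T, τ]
    rw [le_div_iff₀ (hpow _)]
    linarith
  have hST : ∀ i, S i ≤ T i := fun i => by simp only [S]; linarith [hxT i]
  have hcov : ∀ i j, i ⋖ j → T i ≤ S j := by
    intro i j hij
    obtain ⟨C', hi, hC'⟩ := exists_maxChain_above_eq_insert hij (D j) (hD j)
    refine (hDmin i C' hi).trans_eq ?_
    have hj : j ∉ above (D j).1 j := fun h => (mem_above.1 h).2.false
    -- On the rerouted chain `C'`, one further step of the recursion makes `τ C' i` equal to `S j`.
    simp only [S, T, τ, hC']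
    rw [chainSum_insert (fun k hk => (mem_above.1 hk).2), Finset.card_insert_of_notMem hj, pow_succ]
    have := (hpow (above (D j).1 j).card).ne'
    field_simp
    ring
  have hTS : ∀ i j, i < j → T i ≤ S j := by
    intro i
    induction i using WellFoundedGT.induction with
    | ind i ih =>
      intro j hij
      obtain ⟨k, hik, hkj⟩ := hij.exists_covby_le
      rcases hkj.eq_or_lt with rfl | hkj
      · exact hcov i k hik
      · exact (hcov i k hik).trans ((hST k).trans (ih k hik.lt j hkj))
  have hmaxT : ∀ m, (∀ j, ¬ m < j) → T m = 1 := by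
    intro m hm
    have : above (D m).1 m = ∅ :=
      Finset.eq_empty_of_forall_notMem fun j hj => hm j (mem_above.1 hj).2
    simp [T, τ, this, chainSum]
  have h1 : ∀ i, T i ≤ 1 := by
    intro i
    induction i using WellFoundedGT.induction with
    | ind i ih =>
      by_cases h : ∃ j, i < j
      · obtain ⟨j, hij⟩ := h
        exact (hTS i j hij).trans ((hST j).trans (ih j hij))
      · exact (hmaxT i (not_exists.1 h)).le
  have h0 : ∀ i, 0 ≤ S i := by
    intro i
    induction i using WellFoundedLT.induction with
    | ind i ih =>
      by_cases h : ∃ k, k < i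
      · obtain ⟨k, hki⟩ := h
        exact (ih k hki).trans ((hST k).trans (hTS k i hki))
      · have hlt : ∀ j ∈ above (D i).1 i, i < j := fun j hj => (mem_above.1 hj).2
        -- As `i` is minimal in `P`, it is the bottom of its chain, so the `none` inequality for the
        -- whole chain reads `-x i ≤ T i`.
        have hins : (D i).1 = insert i (above (D i).1 i) := by
          ext j
          rw [Finset.mem_insert, mem_above]
          constructor
          · intro hj
            refine or_iff_not_imp_left.2 fun hji => ⟨hj, ?_⟩
            rcases (D i).2.1 hj (hD i) hji with hle | hle
            · exact absurd ⟨j, lt_of_le_of_ne hle hji⟩ h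
            · exact lt_of_le_of_ne hle (Ne.symm hji)
          · rintro (rfl | hj)
            · exact hD j
            · exact hj.1
        have hle := hx ⟨D i, none⟩
        simp only [orderFunctional, LinearMap.neg_apply] at hle
        rw [hins, chainSum_insert hlt] at hle
        have : -x i ≤ T i := by
          simp only [T, τ]
          rw [le_div_iff₀ (hpow _)]
          linarith
        simp only [S]
        linarith
  have := mem_enrichedOrderPolytope_of_interlacing hST hTS h0 h1
  convert this using 1
  ext i
  simp only [S]
  ring

theorem mem_enrichedOrderPolytope_iff [Finite P] (x : P → ℝ) :
    x ∈ enrichedOrderPolytope P ↔ ∀ s, orderFunctional s x ≤ 1 :=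
  ⟨fun hx s => orderFunctional_le_one s hx, mem_enrichedOrderPolytope_of_orderFunctional_le_one⟩

theorem card_orderFunctional_lt [Finite P] (h : ¬ IsAntichain (· ≤ ·) (Set.univ : Set P)) :
    Nat.card (Σ C : MaxChains P, Option C.1) < Nat.card (Σ C : MaxChains P, (C.1 → ℤˣ)) := by
  classical
  cases nonempty_fintype P
  simp only [Nat.card_eq_fintype_card, Fintype.card_sigma, Fintype.card_option, Fintype.card_fun,
    Fintype.card_units_int, Fintype.card_coe]
  refine Finset.sum_lt_sum (fun C _ => Nat.lt_two_pow_self) ?_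
  obtain ⟨i, j, hle, hne⟩ : ∃ i j : P, i ≤ j ∧ i ≠ j := by
    by_contra! hcon
    exact h fun i _ j _ hij hle => hij (hcon i j hle)
  obtain ⟨C, hC⟩ := exists_maxChain_superset (IsChain.pair hle)
  refine ⟨C, Finset.mem_univ _, ?_⟩
  have : 1 < C.1.card := Finset.one_lt_card.2 ⟨i, hC (by simp), j, hC (by simp), hne⟩
  obtain ⟨n, hn⟩ := Nat.exists_eq_add_of_le this
  rw [hn]
  have := Nat.lt_two_pow_self (n := n)
  simp only [pow_add, Nat.succ_eq_add_one]
  omega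

theorem isAntichain_of_numFacets_eq [Finite P]
    (h : numFacets (enrichedOrderPolytope P) = numFacets (enrichedChainPolytope P)) :
    IsAntichain (· ≤ ·) (Set.univ : Set P) := by
  classical
  by_contra hP
  -- For empty `P` the lower bound fails: the polytope is a point without facets, while the empty
  -- maximal chain counts once. But then `P` is trivially an antichain.
  have : Nonempty P := by
    by_contra hne
    rw [not_nonempty_iff] at hne
    exact hP fun i => hne.elim i
  have h1 := numFacets_le_card (mem_enrichedOrderPolytope_iff (P := P))
    vectorSpan_enrichedOrderPolytope
  have h2 := card_le_numFacets_enrichedChainPolytope (P := P)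
  exact (card_orderFunctional_lt hP).not_ge (by exact_mod_cast (h2.trans h.ge).trans h1)

end HalfSpaces

end EnrichedPoset

theorem mainTheorem9 (P : Type*) [Fintype P] [DecidableEq P] [PartialOrder P] :
    [ IsAntichain (· ≤ ·) (Set.univ : Set P),
      EnrichedPoset.UnimodularlyEquivalent
        (EnrichedPoset.enrichedOrderPolytope P) (EnrichedPoset.enrichedChainPolytope P),
      EnrichedPoset.IsCentrallySymmetric (EnrichedPoset.enrichedOrderPolytope P),
      EnrichedPoset.numFacets (EnrichedPoset.enrichedOrderPolytope P) =
        EnrichedPoset.numFacets (EnrichedPoset.enrichedChainPolytope P) ].TFAE := by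
  tfae_have 1 → 2 := by
    intro h
    rw [EnrichedPoset.enrichedOrderPolytope_eq_of_isAntichain h]
    refine ⟨1, 0, by simp, ?_⟩
    convert (Set.image_id (EnrichedPoset.enrichedChainPolytope P)).symm using 2
    ext
    simp
  tfae_have 2 → 4 := EnrichedPoset.UnimodularlyEquivalent.numFacets_eq
  tfae_have 4 → 1 := EnrichedPoset.isAntichain_of_numFacets_eq
  tfae_have 1 → 3 := by
    intro h
    rw [EnrichedPoset.enrichedOrderPolytope_eq_of_isAntichain h]
    exact EnrichedPoset.isCentrallySymmetric_of_neg_eq EnrichedPoset.neg_enrichedChainPolytope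
  tfae_have 3 → 1 := EnrichedPoset.isAntichain_of_isCentrallySymmetric
  tfae_finish
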